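/- Let $k$ be a positive integer, let $\mu_1,\dots,\mu_{2k}$ be Borel probability measures on $\mathbb{R}^2$ with compact support, each absolutely continuous with respect to Lebesgue measure, and let $\alpha_1,\dots,\alpha_{2k}$ be positive real numbers with $\alpha_1+\dots+\alpha_{2k}=1$. Then there are $k$ distinct lines $\ell_1,\dots,\ell_k$ in $\mathbb{R}^2$, closed convex sets $Q_1,\dots,Q_{2k}\subseteq\mathbb{R}^2$ with nonempty, pairwise disjoint interiors, and a permutation $\pi$ of $\{1,\dots,2k\}$ such that 1. $Q_1\cup\dots\cup Q_{2k}=\mathbb{R}^2$, and the boundary of each $Q_i$ is contained in $\ell_1\cup\dots\cup\ell_k$ (that is, $Q_1,\dots,Q_{2k}$ form a partition of the plane into $2k$ convex regions using $k$ lines); 2. $Q_1,\dots,Q_{2k}$ are in counterclockwise order, in the following sense: for every sufficiently large $r$ there are real numbers $t_0<t_1<\dots<t_{2k}=t_0+2\pi$ such that for every $i$ the intersection of $Q_i$ with the circle of radius $r$ around the origin is the arc $\{(r\cos\theta,r\sin\theta): t_{i-1}\le\theta\le t_i\}$; 3. $\mu_{\pi(i)}(Q_i)\ge\alpha_i$ for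 every $i\in\{1,\dots,2k\}$. -/

import Mathlib

open MeasureTheory

/-- The Euclidean plane. -/
abbrev Plane : Type := EuclideanSpace ℝ (Fin 2)

/-- The point at angle `θ` on the circle of radius `r` around the origin; as `θ` increases the
point travels counterclockwise. -/
noncomputable def circlePoint (r θ : ℝ) : Plane := !₂[r * Real.cos θ, r * Real.sin θ]

/-- The sets `Q i` are a partition of the plane into `n` convex regions using the `k` distinct
lines `L j`. As usual for convex partitions, the regions are closed and may share boundary points,
and the dividing boundaries are made of pieces of the lines. -/
structure IsConvexPartitionByLines {n k : ℕ}
    (L : Fin k → AffineSubspace ℝ Plane) (Q : Fin n → Set Plane) : Prop where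
  finrank_direction : ∀ j, Module.finrank ℝ (L j).direction = 1
  injective : Function.Injective L
  isClosed : ∀ i, IsClosed (Q i)
  convex : ∀ i, Convex ℝ (Q i)
  interior_nonempty : ∀ i, (interior (Q i)).Nonempty
  disjoint_interior : ∀ i i', i ≠ i' → Disjoint (interior (Q i)) (interior (Q i'))
  iUnion_eq : ⋃ i, Q i = Set.univ
  frontier_subset : ∀ i, frontier (Q i) ⊆ ⋃ j, (L j : Set Plane)

/-- The regions `Q 0, …, Q (n - 1)` are in counterclockwise order: every sufficiently large circle
around the origin, traversed once counterclockwise from a suitable point, passes through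
`Q 0, …, Q (n - 1)` in this order, meeting each of them in exactly one nondegenerate arc. -/
def InCounterclockwiseOrder {n : ℕ} (Q : Fin n → Set Plane) : Prop :=
  ∃ R : ℝ, 0 < R ∧ ∀ r : ℝ, R ≤ r → ∃ t : Fin (n + 1) → ℝ,
    StrictMono t ∧ t (Fin.last n) = t 0 + 2 * Real.pi ∧
    ∀ i : Fin n, Q i ∩ Metric.sphere (0 : Plane) r =
      circlePoint r '' Set.Icc (t i.castSucc) (t i.succ)

/-! The proof is a moving-knife argument; regard the measures as players. For a fixed direction each
player has a position of the line that splits the mass into `α 0 + … + α (k-1)` behind and the rest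
in front. At the `k`-th smallest position, `k` players are content with the back side `U` and the
others with the front side `D` (`exists_halving_players`).

Let the line turn by half a turn, placed so that the largest value its piece of `U` has for a player
of `U` is exactly the next share. The largest value of the opposite piece of `D` for a player of `D`
starts at zero and ends above the share due there, so at some angle it equals that share
(`exists_common_value`, `exists_line_cutting`). One player on each side leaves with that piece.
Nobody left values it above the share, so the others still have enough, and the new line serves as
the next starting line (`exists_lines_cutting`). The last two players take what remains.

The angles increase within half a turn, so adding the reversed lines gives an `IsLineCycle`. On a
large circle the points behind line `j` form an arc from `t j` to `t (j + k)` with `t` increasing,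
so region `i` is the arc from `t i` to `t (i + 1)`. -/

/-! ### Oriented lines and half-planes. -/

/-- The signed coordinate of a point in the direction `θ`, as a linear functional. -/
noncomputable def side (θ : ℝ) : Plane →ₗ[ℝ] ℝ :=
  Real.cos θ • EuclideanSpace.projₗ 0 + Real.sin θ • EuclideanSpace.projₗ 1

lemma side_apply (θ : ℝ) (x : Plane) :
    side θ x = Real.cos θ * x 0 + Real.sin θ * x 1 := by
  simp [side]

lemma continuous_side (θ : ℝ) : Continuous fun x : Plane => side θ x :=
  (side θ).continuous_of_finiteDimensional

lemma side_add_pi (θ : ℝ) (x : Plane) : side (θ + Real.pi) x = -side θ x := by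
  simp only [side_apply, Real.cos_add_pi, Real.sin_add_pi]
  ring

lemma side_circlePoint (θ r φ : ℝ) : side θ (circlePoint r φ) = r * Real.cos (φ - θ) := by
  simp only [side_apply, circlePoint, Real.cos_sub]
  simp
  ring

lemma side_ne_zero (θ : ℝ) : side θ ≠ 0 := by
  intro h
  have := side_circlePoint θ 1 θ
  simp [h] at this

/-- The line of points whose coordinate in the direction `θ` is `s`. -/
noncomputable def levelLine (θ s : ℝ) : AffineSubspace ℝ Plane :=
  AffineSubspace.mk' (circlePoint s θ) (LinearMap.ker (side θ))

lemma mem_levelLine {θ s : ℝ} {x : Plane} : x ∈ levelLine θ s ↔ side θ x = s := by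
  simp [levelLine, AffineSubspace.mem_mk', side_circlePoint, sub_eq_zero]

lemma direction_levelLine (θ s : ℝ) :
    (levelLine θ s).direction = LinearMap.ker (side θ) := by
  rw [levelLine, AffineSubspace.direction_mk']

lemma finrank_levelLine (θ s : ℝ) : Module.finrank ℝ (levelLine θ s).direction = 1 := by
  have := Module.Dual.finrank_ker_add_one_of_ne_zero (side_ne_zero θ)
  simp only [finrank_euclideanSpace, Fintype.card_fin] at this
  rw [direction_levelLine]
  omega

lemma volume_side_eq (θ s : ℝ) : volume {x : Plane | side θ x = s} = 0 := by
  have h : {x : Plane | side θ x = s} = (levelLine θ s : Set Plane) := by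
    ext x
    simp [mem_levelLine]
  rw [h]
  refine Measure.addHaar_affineSubspace _ _ fun h => ?_
  have := finrank_levelLine θ s
  rw [h, AffineSubspace.direction_top, finrank_top] at this
  simp at this

lemma levelLine_ne {θ s θ' s' : ℝ} (h : θ < θ') (h' : θ' < θ + Real.pi) :
    levelLine θ s ≠ levelLine θ' s' := by
  intro he
  have hd : LinearMap.ker (side θ) = LinearMap.ker (side θ') := by
    rw [← direction_levelLine θ s, he, direction_levelLine]
  have hm : circlePoint 1 (θ + Real.pi / 2) ∈ LinearMap.ker (side θ) := by
    simp [LinearMap.mem_ker, side_circlePoint]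
  rw [hd, LinearMap.mem_ker, side_circlePoint, one_mul] at hm
  have : 0 < Real.cos (θ + Real.pi / 2 - θ') :=
    Real.cos_pos_of_mem_Ioo ⟨by linarith, by linarith⟩
  linarith

lemma isOpen_side_lt (θ s : ℝ) : IsOpen {x : Plane | side θ x < s} :=
  isOpen_lt (continuous_side θ) continuous_const

lemma isOpen_lt_side (θ s : ℝ) : IsOpen {x : Plane | s < side θ x} :=
  isOpen_lt continuous_const (continuous_side θ)

/-- A common interior would be an open subset of a null line. -/
lemma disjoint_interior_of_side {A B : Set Plane} {θ s : ℝ}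
    (hA : ∀ x ∈ A, side θ x ≤ s) (hB : ∀ x ∈ B, s ≤ side θ x) :
    Disjoint (interior A) (interior B) := by
  rw [Set.disjoint_iff]
  intro x hx
  have hsub : interior A ∩ interior B ⊆ {y | side θ y = s} := fun y hy =>
    le_antisymm (hA y (interior_subset hy.1)) (hB y (interior_subset hy.2))
  have hopen : IsOpen (interior A ∩ interior B) := isOpen_interior.inter isOpen_interior
  exact (hopen.measure_pos volume ⟨x, hx⟩).ne' (measure_mono_null hsub (volume_side_eq θ s))

/-! ### The convex partition cut out by a cycle of lines. -/

/-- The `i`-th region cut out by the lines `side (θ j) = s j`: the points behind the lines of the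
same half of the index range up to `i`, and in front of the next one. -/
def region (k : ℕ) (θ s : ℕ → ℝ) (i : ℕ) : Set Plane :=
  {x | (∀ j ≤ i, (i < k ∨ k ≤ j) → side (θ j) x ≤ s j) ∧ s (i + 1) ≤ side (θ (i + 1)) x}

/-- A sequence of oriented lines in increasing direction, where the line of index `j + k` is the
line of index `j` with the opposite orientation. -/
structure IsLineCycle (k : ℕ) (θ s : ℕ → ℝ) : Prop where
  pos : 0 < k
  strictMono : StrictMono θ
  angle_add : ∀ j, θ (j + k) = θ j + Real.pi
  offset_add : ∀ j, s (j + k) = -s j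

section Region

variable {k : ℕ} {θ s : ℕ → ℝ}

lemma isClosed_region (i : ℕ) : IsClosed (region k θ s i) := by
  have h : region k θ s i = (⋂ j, ⋂ (_ : j ≤ i), ⋂ (_ : i < k ∨ k ≤ j),
      {x | side (θ j) x ≤ s j}) ∩ {x | s (i + 1) ≤ side (θ (i + 1)) x} := by
    ext x
    simp [region]
  rw [h]
  refine IsClosed.inter ?_ (isClosed_le continuous_const (continuous_side _))
  exact isClosed_iInter fun j => isClosed_iInter fun _ => isClosed_iInter fun _ =>
    isClosed_le (continuous_side _) continuous_const

lemma convex_region (i : ℕ) : Convex ℝ (region k θ s i) := by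
  have h : region k θ s i = (⋂ j, ⋂ (_ : j ≤ i), ⋂ (_ : i < k ∨ k ≤ j),
      {x | side (θ j) x ≤ s j}) ∩ {x | s (i + 1) ≤ side (θ (i + 1)) x} := by
    ext x
    simp [region]
  rw [h]
  refine Convex.inter ?_ (convex_halfSpace_ge (side _).isLinear _)
  exact convex_iInter fun j => convex_iInter fun _ => convex_iInter fun _ =>
    convex_halfSpace_le (side _).isLinear _

namespace IsLineCycle

variable (h : IsLineCycle k θ s)
include h

lemma le_side_iff (j : ℕ) (x : Plane) :
    s (j + k) ≤ side (θ (j + k)) x ↔ side (θ j) x ≤ s j := by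
  rw [h.angle_add, h.offset_add, side_add_pi, neg_le_neg_iff]

lemma side_le_iff (j : ℕ) (x : Plane) :
    side (θ (j + k)) x ≤ s (j + k) ↔ s j ≤ side (θ j) x := by
  rw [h.angle_add, h.offset_add, side_add_pi, neg_le_neg_iff]

/-- Start from line `0` or its reversal, whichever has `x` behind it, and stop just before the first
later line with `x` in front. The search ends within `k` steps, where the starting line returns
reversed. -/
lemma exists_mem_region (x : Plane) : ∃ i < 2 * k, x ∈ region k θ s i := by
  classical
  have hk := h.pos
  have main : ∀ c, (c = 0 ∨ c = k) → side (θ c) x ≤ s c → ∃ i < 2 * k, x ∈ region k θ s i := by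
    intro c hc hx
    have hex : ∃ m, s (c + m + 1) ≤ side (θ (c + m + 1)) x := by
      refine ⟨k - 1, ?_⟩
      rw [show c + (k - 1) + 1 = c + k by omega]
      exact (h.le_side_iff c x).2 hx
    have hlt : Nat.find hex ≤ k - 1 := by
      refine Nat.find_min' hex ?_
      rw [show c + (k - 1) + 1 = c + k by omega]
      exact (h.le_side_iff c x).2 hx
    refine ⟨c + Nat.find hex, by omega, fun j hj hjk => ?_, Nat.find_spec hex⟩
    rcases eq_or_ne j c with rfl | hne
    · exact hx
    · have := Nat.find_min hex (m := j - c - 1) (by omega)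
      rw [show c + (j - c - 1) + 1 = j by omega] at this
      exact (not_le.1 this).le
  rcases le_total (side (θ 0) x) (s 0) with hx | hx
  · exact main 0 (Or.inl rfl) hx
  · refine main k (Or.inr rfl) ?_
    have := (h.side_le_iff 0 x).2 hx
    simpa using this

/-- Within one half of the index range line `i + 1` separates the regions; across the halves line
`0` does. -/
lemma disjoint_interior_region {i i' : ℕ} (hi : i < i') :
    Disjoint (interior (region k θ s i)) (interior (region k θ s i')) := by
  by_cases hs : i' < k ∨ k ≤ i
  · exact (disjoint_interior_of_side (θ := θ (i + 1)) (s := s (i + 1))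
      (fun x hx => hx.1 (i + 1) (by omega) (by omega)) (fun x hx => hx.2)).symm
  · refine disjoint_interior_of_side (θ := θ 0) (s := s 0)
      (fun x hx => hx.1 0 (by omega) (by omega)) (fun x hx => ?_)
    have := hx.1 (0 + k) (by omega) (by omega)
    exact (h.side_le_iff 0 x).1 this

lemma levelLine_add (j : ℕ) : levelLine (θ (j + k)) (s (j + k)) = levelLine (θ j) (s j) := by
  ext x
  rw [mem_levelLine, mem_levelLine, h.angle_add, h.offset_add, side_add_pi, neg_inj]

lemma exists_levelLine_eq {j : ℕ} (hj : j ≤ 2 * k) :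
    ∃ j' < k, levelLine (θ j) (s j) = levelLine (θ j') (s j') := by
  have hk := h.pos
  rcases lt_or_ge j k with h1 | h1
  · exact ⟨j, h1, rfl⟩
  · obtain ⟨m, rfl⟩ := Nat.exists_eq_add_of_le' h1
    rcases lt_or_ge m k with h2 | h2
    · exact ⟨m, h2, h.levelLine_add m⟩
    · obtain rfl : m = 0 + k := by omega
      exact ⟨0, hk, by rw [h.levelLine_add, h.levelLine_add]⟩

/-- Off all lines the finitely many defining inequalities are strict, hence persist nearby. -/
lemma frontier_region_subset {i : ℕ} (hi : i < 2 * k) :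
    frontier (region k θ s i) ⊆ ⋃ j : Fin k, (levelLine (θ j) (s j) : Set Plane) := by
  intro x hx
  by_contra hcon
  have hne : ∀ j ≤ 2 * k, side (θ j) x ≠ s j := by
    intro j hj he
    obtain ⟨j', hj', hl⟩ := h.exists_levelLine_eq hj
    refine hcon (Set.mem_iUnion.2 ⟨⟨j', hj'⟩, ?_⟩)
    have : x ∈ levelLine (θ j) (s j) := mem_levelLine.2 he
    rw [hl] at this
    exact this
  have hmem : x ∈ region k θ s i := (isClosed_region i).frontier_subset hx
  refine hx.2 (mem_interior_iff_mem_nhds.2 ?_)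
  have h1 : ∀ᶠ y in nhds x, ∀ j ∈ Finset.range (i + 1),
      (i < k ∨ k ≤ j) → side (θ j) y ≤ s j := by
    rw [Filter.eventually_all_finset]
    intro j hj
    by_cases hc : i < k ∨ k ≤ j
    · have hj' : j ≤ i := by simpa [Nat.lt_succ_iff] using hj
      have hlt := lt_of_le_of_ne (hmem.1 j hj' hc) (hne j (by omega))
      filter_upwards [(isOpen_side_lt (θ j) (s j)).mem_nhds hlt] with y hy _ using le_of_lt hy
    · exact Filter.Eventually.of_forall fun y hy => absurd hy hc
  have h2 : ∀ᶠ y in nhds x, s (i + 1) ≤ side (θ (i + 1)) y := by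
    have hlt := lt_of_le_of_ne hmem.2 (hne (i + 1) (by omega)).symm
    filter_upwards [(isOpen_lt_side (θ (i + 1)) (s (i + 1))).mem_nhds hlt] with y hy
      using le_of_lt hy
  filter_upwards [h1, h2] with y hy1 hy2
  exact ⟨fun j hj => hy1 j (by simpa [Nat.lt_succ_iff] using hj), hy2⟩

lemma angle_lt_add_pi {i j : ℕ} (hij : j < i + k) : θ j < θ i + Real.pi := by
  rw [← h.angle_add]
  exact h.strictMono hij

lemma isConvexPartitionByLines
    (hne : ∀ i < 2 * k, (interior (region k θ s i)).Nonempty) :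
    IsConvexPartitionByLines (fun j : Fin k => levelLine (θ j) (s j))
      (fun i : Fin (2 * k) => region k θ s i) where
  finrank_direction j := finrank_levelLine _ _
  injective := by
    have key : ∀ j j' : Fin k, j < j' →
        levelLine (θ j) (s j) ≠ levelLine (θ j') (s j') := fun j j' hj =>
      levelLine_ne (h.strictMono hj) (h.angle_lt_add_pi (by omega))
    intro j j' he
    rcases lt_trichotomy j j' with hlt | heq | hgt
    · exact absurd he (key j j' hlt)
    · exact heq
    · exact absurd he.symm (key j' j hgt)
  isClosed i := isClosed_region _
  convex i := convex_region _
  interior_nonempty i := hne i i.2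
  disjoint_interior i i' hi := by
    rcases lt_or_gt_of_ne hi with hlt | hgt
    · exact h.disjoint_interior_region hlt
    · exact (h.disjoint_interior_region hgt).symm
  iUnion_eq := by
    refine Set.eq_univ_of_forall fun x => ?_
    obtain ⟨i, hi, hx⟩ := h.exists_mem_region x
    exact Set.mem_iUnion.2 ⟨⟨i, hi⟩, hx⟩
  frontier_subset i := h.frontier_region_subset i.2

end IsLineCycle

end Region

/-! ### Counterclockwise order on large circles. -/

/-- No bound `s ≤ r` is needed: for `s / r > 1` the value of `Real.arccos` is `0`, and the cosine is
at most `1` anyway. -/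
lemma side_circlePoint_lt {θ s r φ : ℝ} (hr : 0 < r) (h1 : -r ≤ s)
    (hφ : θ + Real.arccos (s / r) < φ) (hφ' : φ < θ + 2 * Real.pi - Real.arccos (s / r)) :
    side θ (circlePoint r φ) < s := by
  rw [side_circlePoint]
  have h0 := Real.arccos_nonneg (s / r)
  have hpi := Real.arccos_le_pi (s / r)
  have hle : (-1 : ℝ) ≤ s / r := by rw [le_div_iff₀ hr]; linarith
  have hle' : Real.cos (Real.arccos (s / r)) ≤ s / r := by
    rcases le_total (s / r) 1 with h | h
    · exact (Real.cos_arccos hle h).le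
    · exact (Real.cos_le_one _).trans h
  have hcos : Real.cos (φ - θ) < Real.cos (Real.arccos (s / r)) := by
    rcases le_total (φ - θ) Real.pi with h | h
    · exact Real.cos_lt_cos_of_nonneg_of_le_pi h0 h (by linarith)
    · rw [← Real.cos_two_pi_sub (φ - θ)]
      exact Real.cos_lt_cos_of_nonneg_of_le_pi h0 (by linarith) (by linarith)
  have := hcos.trans_le hle'
  rw [lt_div_iff₀ hr] at this
  linarith

lemma side_circlePoint_le {θ s r φ : ℝ} (hr : 0 < r) (h1 : -r ≤ s)
    (hφ : θ + Real.arccos (s / r) ≤ φ) (hφ' : φ ≤ θ + 2 * Real.pi - Real.arccos (s / r)) :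
    side θ (circlePoint r φ) ≤ s := by
  rw [side_circlePoint]
  have h0 := Real.arccos_nonneg (s / r)
  have hpi := Real.arccos_le_pi (s / r)
  have hle : (-1 : ℝ) ≤ s / r := by rw [le_div_iff₀ hr]; linarith
  have hle' : Real.cos (Real.arccos (s / r)) ≤ s / r := by
    rcases le_total (s / r) 1 with h | h
    · exact (Real.cos_arccos hle h).le
    · exact (Real.cos_le_one _).trans h
  have hcos : Real.cos (φ - θ) ≤ Real.cos (Real.arccos (s / r)) := by
    rcases le_total (φ - θ) Real.pi with h | h
    · exact Real.cos_le_cos_of_nonneg_of_le_pi h0 h (by linarith)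
    · rw [← Real.cos_two_pi_sub (φ - θ)]
      exact Real.cos_le_cos_of_nonneg_of_le_pi h0 (by linarith) (by linarith)
  have := hcos.trans hle'
  rw [le_div_iff₀ hr] at this
  linarith

lemma circlePoint_add_two_pi (r φ : ℝ) : circlePoint r (φ + 2 * Real.pi) = circlePoint r φ := by
  simp [circlePoint]

lemma circlePoint_mem_sphere {r : ℝ} (hr : 0 ≤ r) (φ : ℝ) :
    circlePoint r φ ∈ Metric.sphere (0 : Plane) r := by
  rw [mem_sphere_zero_iff_norm, EuclideanSpace.norm_eq, Fin.sum_univ_two]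
  have : ‖circlePoint r φ 0‖ ^ 2 + ‖circlePoint r φ 1‖ ^ 2 = r ^ 2 := by
    simp only [circlePoint, Real.norm_eq_abs, sq_abs]
    simp only [Matrix.cons_val_zero, Matrix.cons_val_one]
    linear_combination r ^ 2 * Real.cos_sq_add_sin_sq φ
  rw [this, Real.sqrt_sq hr]

lemma exists_circlePoint_eq {r : ℝ} {x : Plane}
    (hx : x ∈ Metric.sphere (0 : Plane) r) (a : ℝ) :
    ∃ φ, a ≤ φ ∧ φ < a + 2 * Real.pi ∧ x = circlePoint r φ := by
  have hnorm : ‖(⟨x 0, x 1⟩ : ℂ)‖ = r := by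
    rw [mem_sphere_zero_iff_norm, EuclideanSpace.norm_eq, Fin.sum_univ_two] at hx
    rw [← hx, Complex.norm_eq_sqrt_sq_add_sq]
    simp
  set z : ℂ := ⟨x 0, x 1⟩ with hz
  have hc : x = circlePoint r z.arg := by
    ext i
    fin_cases i
    · have := Complex.norm_mul_cos_arg z
      rw [hnorm] at this
      exact this.symm
    · have := Complex.norm_mul_sin_arg z
      rw [hnorm] at this
      exact this.symm
  have hp : Function.Periodic (circlePoint r) (2 * Real.pi) := circlePoint_add_two_pi r
  refine ⟨toIcoMod Real.two_pi_pos a z.arg, left_le_toIcoMod _ _ _, toIcoMod_lt_right _ _ _, ?_⟩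
  rw [hc, toIcoMod, hp.sub_zsmul_eq]

namespace IsLineCycle

variable {k : ℕ} {θ s : ℕ → ℝ} (h : IsLineCycle k θ s)
include h

lemma endpoint_add (r : ℝ) (j : ℕ) : θ (j + k) + Real.arccos (s (j + k) / r) =
    θ j + 2 * Real.pi - Real.arccos (s j / r) := by
  rw [h.angle_add, h.offset_add, neg_div, Real.arccos_neg]
  ring

/-- As `r` grows the endpoints tend to `θ j + π / 2`, so they inherit the order of the angles. -/
lemma eventually_endpoint_lt (i : ℕ) : ∀ᶠ r : ℝ in Filter.atTop,
    θ i + Real.arccos (s i / r) < θ (i + 1) + Real.arccos (s (i + 1) / r) := by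
  have hlim : ∀ j, Filter.Tendsto (fun r : ℝ => θ j + Real.arccos (s j / r)) Filter.atTop
      (nhds (θ j + Real.pi / 2)) := by
    intro j
    have h1 : Filter.Tendsto (fun r : ℝ => s j / r) Filter.atTop (nhds 0) :=
      Filter.Tendsto.const_div_atTop Filter.tendsto_id _
    have h2 := (Real.continuous_arccos.tendsto 0).comp h1
    rw [Real.arccos_zero] at h2
    exact h2.const_add _
  exact (hlim i).eventually_lt (hlim (i + 1)) (by
    have := h.strictMono (Nat.lt_succ_self i)
    simp only [Nat.succ_eq_add_one] at this
    linarith)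

lemma inCounterclockwiseOrder :
    InCounterclockwiseOrder (fun i : Fin (2 * k) => region k θ s i) := by
  have hk := h.pos
  -- The comparisons below reach index `i + 1 + 2 * k ≤ 4 * k`.
  have hev : ∀ᶠ r : ℝ in Filter.atTop, 0 < r ∧ (∀ j ∈ Finset.range (4 * k), -r ≤ s j) ∧
      ∀ j ∈ Finset.range (4 * k),
        θ j + Real.arccos (s j / r) < θ (j + 1) + Real.arccos (s (j + 1) / r) := by
    refine (Filter.eventually_gt_atTop 0).and (Filter.Eventually.and ?_ ?_)
    · rw [Filter.eventually_all_finset]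
      intro j _
      filter_upwards [Filter.eventually_ge_atTop (-s j)] with r hr
      linarith
    · rw [Filter.eventually_all_finset]
      exact fun j _ => h.eventually_endpoint_lt j
  obtain ⟨R, hR⟩ := Filter.eventually_atTop.1 hev
  refine ⟨R, (hR R le_rfl).1, fun r hr => ?_⟩
  obtain ⟨hr0, hs, hlt⟩ := hR r hr
  set t : ℕ → ℝ := fun j => θ j + Real.arccos (s j / r) with ht
  have hmono : ∀ i j, i < j → j ≤ 4 * k → t i < t j := by
    intro i j hij
    induction j, hij using Nat.le_induction with
    | base => exact fun hj => hlt i (by simpa using hj)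
    | succ j hij ih =>
      exact fun hj => (ih (by omega)).trans (hlt j (by simpa using hj))
  have hmono' : ∀ i j, i ≤ j → j ≤ 4 * k → t i ≤ t j := by
    intro i j hij hj
    rcases hij.eq_or_lt with rfl | hlt'
    · exact le_rfl
    · exact (hmono i j hlt' hj).le
  have htk : ∀ j, t (j + k) = θ j + 2 * Real.pi - Real.arccos (s j / r) := h.endpoint_add r
  have htkk : ∀ j, t (j + k + k) = t j + 2 * Real.pi := by
    intro j
    rw [htk, h.angle_add, h.offset_add, neg_div, Real.arccos_neg]
    simp only [ht]
    ring
  have hsle : ∀ j < 4 * k, ∀ φ, t j ≤ φ → φ ≤ t (j + k) → side (θ j) (circlePoint r φ) ≤ s j :=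
    fun j hj φ h1 h2 => side_circlePoint_le hr0 (hs j (by simpa using hj)) h1 (htk j ▸ h2)
  have hslt : ∀ j < 4 * k, ∀ φ, t j < φ → φ < t (j + k) → side (θ j) (circlePoint r φ) < s j :=
    fun j hj φ h1 h2 => side_circlePoint_lt hr0 (hs j (by simpa using hj)) h1 (htk j ▸ h2)
  refine ⟨fun i => t i, fun i j hij => hmono i j hij (by omega), ?_, fun i => ?_⟩
  · have := htkk 0
    simp only [Fin.val_last, Fin.val_zero]
    rw [← this]
    congr 1
    omega
  · have hi := i.2
    simp only [Fin.val_castSucc, Fin.val_succ]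
    ext x
    constructor
    · rintro ⟨hx, hxr⟩
      obtain ⟨φ, h1, h2, rfl⟩ := exists_circlePoint_eq hxr (t i)
      rw [← htkk] at h2
      have h3 : φ ≤ t (i + k) := by
        by_contra! hcon
        have hlt1 := hslt (i + k) (by omega) φ hcon h2
        exact absurd ((h.le_side_iff i _).2 (hx.1 i le_rfl (by omega))) (not_le.2 hlt1)
      refine ⟨φ, ⟨h1, ?_⟩, rfl⟩
      by_contra! hcon
      refine absurd hx.2 (not_le.2 (hslt (i + 1) (by omega) φ hcon (h3.trans_lt ?_)))
      exact hmono _ _ (by omega) (by omega)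
    · rintro ⟨φ, ⟨h1, h2⟩, rfl⟩
      refine ⟨⟨fun j hj hjk => ?_, ?_⟩, circlePoint_mem_sphere hr0.le φ⟩
      · exact hsle j (by omega) φ ((hmono' _ _ hj (by omega)).trans h1)
          (h2.trans (hmono' _ _ (by omega) (by omega)))
      -- Being in front of line `i + 1` means being behind its reversal, whose arc starts at `t (i +
      -- 1 + k)`; hence the shift of `φ` by a full turn.
      · rw [← h.side_le_iff, ← circlePoint_add_two_pi]
        refine hsle _ (by omega) _ ?_ ?_
        · calc t (i + 1 + k) ≤ t (i + k + k) := hmono' _ _ (by omega) (by omega)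
            _ ≤ _ := by rw [htkk]; linarith
        · rw [htkk]; linarith

end IsLineCycle

/-! ### The moving-knife intermediate value theorem. -/

/-- A continuous one-parameter family of moving knives: at some parameter the position at which
`f` takes the value `α` can be chosen so that `g` takes the value `β`. -/
lemma exists_common_value {f g : ℝ → ℝ → ℝ} {a b R α β : ℝ} (hab : a ≤ b)
    (hf : Continuous (Function.uncurry f)) (hg : Continuous (Function.uncurry g))
    (hanti : ∀ θ, Antitone (f θ)) (hlow : ∀ θ, α < f θ (-R)) (hhigh : ∀ θ, f θ R < α)
    (ha : ∀ s, f a s = α → g a s < β) (hb : ∀ s, f b s = α → β < g b s) :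
    ∃ θ, a < θ ∧ θ < b ∧ ∃ s, f θ s = α ∧ g θ s = β := by
  suffices H : ∃ θ ∈ Set.Icc a b, ∃ s, f θ s = α ∧ g θ s = β by
    obtain ⟨θ, hθ, s, h1, h2⟩ := H
    refine ⟨θ, lt_of_le_of_ne hθ.1 ?_, lt_of_le_of_ne hθ.2 ?_, s, h1, h2⟩
    · rintro rfl
      exact (ha s h1).ne h2
    · rintro rfl
      exact (hb s h1).ne' h2
  have hbox : ∀ θ s, f θ s = α → s ∈ Set.Icc (-R) R := by
    intro θ s hs
    constructor
    · by_contra! hlt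
      exact absurd (hanti θ hlt.le) (by rw [hs]; exact not_le.2 (hlow θ))
    · by_contra! hlt
      exact absurd (hanti θ hlt.le) (by rw [hs]; exact not_le.2 (hhigh θ))
  have hRR : -R ≤ R := by
    by_contra! hlt
    exact absurd (hanti a hlt.le) (not_le.2 ((hhigh a).trans (hlow a)))
  have hfθ : ∀ θ, Continuous (f θ) := fun θ => hf.comp (Continuous.prodMk_right θ)
  have hgθ : ∀ θ, Continuous (g θ) := fun θ => hg.comp (Continuous.prodMk_right θ)
  have hex : ∀ θ, ∃ s, f θ s = α := by
    intro θ
    obtain ⟨s, -, hs⟩ := intermediate_value_Icc' hRR (hfθ θ).continuousOn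
      ⟨(hhigh θ).le, (hlow θ).le⟩
    exact ⟨s, hs⟩
  -- The position `s` need not be unique or continuous in `θ`. Projecting a compact set of pairs
  -- still gives closed sets of angles, and connectedness of `[a, b]` makes the sets for `g ≤ β` and
  -- `g ≥ β` meet.
  have hclosed : ∀ C : Set ℝ, IsClosed C →
      IsClosed (Prod.fst '' ({p : ℝ × ℝ | p.1 ∈ Set.Icc a b ∧ p.2 ∈ Set.Icc (-R) R} ∩
        {p | f p.1 p.2 = α ∧ g p.1 p.2 ∈ C})) := by
    intro C hC
    refine (IsCompact.image ?_ continuous_fst).isClosed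
    refine IsCompact.inter_right (isCompact_Icc.prod isCompact_Icc) ?_
    exact (isClosed_eq hf continuous_const).inter (hC.preimage hg)
  have hcover : ∀ θ ∈ Set.Icc a b, ∀ C : Set ℝ, ∀ s, f θ s = α → g θ s ∈ C →
      θ ∈ Prod.fst '' ({p : ℝ × ℝ | p.1 ∈ Set.Icc a b ∧ p.2 ∈ Set.Icc (-R) R} ∩
        {p | f p.1 p.2 = α ∧ g p.1 p.2 ∈ C}) :=
    fun θ hθ C s h1 h2 => ⟨(θ, s), ⟨⟨hθ, hbox θ s h1⟩, h1, h2⟩, rfl⟩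
  obtain ⟨θ, hθ, ⟨⟨θ₁, s₁⟩, ⟨-, h1, h1'⟩, rfl⟩, ⟨⟨θ₂, s₂⟩, ⟨-, h2, h2'⟩, he⟩⟩ :=
    isPreconnected_closed_iff.1 (isPreconnected_Icc (a := a) (b := b)) _ _
      (hclosed (Set.Iic β) isClosed_Iic) (hclosed (Set.Ici β) isClosed_Ici)
      (fun θ hθ => by
        obtain ⟨s, hs⟩ := hex θ
        rcases le_total (g θ s) β with hle | hle
        · exact Or.inl (hcover θ hθ _ s hs hle)
        · exact Or.inr (hcover θ hθ _ s hs hle))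
      (by
        obtain ⟨s, hs⟩ := hex a
        exact ⟨a, Set.left_mem_Icc.2 hab, hcover a (Set.left_mem_Icc.2 hab) _ s hs (ha s hs).le⟩)
      (by
        obtain ⟨s, hs⟩ := hex b
        exact ⟨b, Set.right_mem_Icc.2 hab,
          hcover b (Set.right_mem_Icc.2 hab) _ s hs (hb s hs).le⟩)
  simp only at he h1 h1' h2 h2' hθ
  subst he
  -- By monotonicity `f θ₂` equals `α` throughout between `s₁` and `s₂`.
  obtain ⟨s, hs, hgs⟩ := isPreconnected_uIcc.intermediate_value (a := s₁) (b := s₂)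
    Set.left_mem_uIcc Set.right_mem_uIcc (hgθ θ₂).continuousOn ⟨h1', h2'⟩
  refine ⟨θ₂, hθ, s, le_antisymm ?_ ?_, hgs⟩
  · rcases Set.mem_uIcc.1 hs with h | h
    · exact h1 ▸ hanti θ₂ h.1
    · exact h2 ▸ hanti θ₂ h.1
  · rcases Set.mem_uIcc.1 hs with h | h
    · exact h2 ▸ hanti θ₂ h.2
    · exact h1 ▸ hanti θ₂ h.2

/-! ### Masses of half-planes. -/

lemma measurableSet_le_side (θ s : ℝ) : MeasurableSet {x : Plane | s ≤ side θ x} :=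
  (isClosed_le continuous_const (continuous_side θ)).measurableSet

lemma measurableSet_side_le (θ s : ℝ) : MeasurableSet {x : Plane | side θ x ≤ s} :=
  (isClosed_le (continuous_side θ) continuous_const).measurableSet

section Measure

variable {μ : Measure Plane} [IsProbabilityMeasure μ]

omit [IsProbabilityMeasure μ] in
lemma measureReal_side_eq (habs : μ ≪ volume) (θ s : ℝ) : μ.real {x | side θ x = s} = 0 := by
  rw [measureReal_def, habs (volume_side_eq θ s), ENNReal.toReal_zero]

/-- Dominated convergence: the indicator can jump only at points of the limiting line, which are
null. -/
lemma continuous_measure_le_side (habs : μ ≪ volume) {U : Set Plane} (hU : MeasurableSet U) :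
    Continuous fun p : ℝ × ℝ => μ.real (U ∩ {x | p.2 ≤ side p.1 x}) := by
  have hm : ∀ p : ℝ × ℝ, MeasurableSet (U ∩ {x | p.2 ≤ side p.1 x}) := fun p =>
    hU.inter (measurableSet_le_side p.1 p.2)
  have heq : (fun p : ℝ × ℝ => μ.real (U ∩ {x | p.2 ≤ side p.1 x})) =
      fun p : ℝ × ℝ => ∫ x, (U ∩ {x | p.2 ≤ side p.1 x}).indicator (1 : Plane → ℝ) x ∂μ := by
    funext p
    exact (integral_indicator_one (hm p)).symm
  rw [heq, continuous_iff_continuousAt]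
  intro p
  refine continuousAt_of_dominated (bound := fun _ => (1 : ℝ)) ?_ ?_ (integrable_const _) ?_
  · exact Filter.Eventually.of_forall fun q =>
      (measurable_one.indicator (hm q)).aestronglyMeasurable
  · refine Filter.Eventually.of_forall fun q => Filter.Eventually.of_forall fun x => ?_
    by_cases hx : x ∈ U ∩ {x | q.2 ≤ side q.1 x}
    · simp [Set.indicator_of_mem hx]
    · simp [Set.indicator_of_notMem hx]
  · have hnull : ∀ᵐ x ∂μ, side p.1 x ≠ p.2 := by
      rw [ae_iff]
      simpa using habs (volume_side_eq p.1 p.2)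
    filter_upwards [hnull] with x hx
    have hc : Continuous fun q : ℝ × ℝ => side q.1 x := by
      simp only [side_apply]
      fun_prop
    have hev : ∀ᶠ q : ℝ × ℝ in nhds p, (q.2 ≤ side q.1 x ↔ p.2 ≤ side p.1 x) := by
      rcases lt_or_gt_of_ne hx with hlt | hgt
      · filter_upwards [(isOpen_lt hc continuous_snd).mem_nhds hlt] with q hq
        exact iff_of_false (not_le.2 hq) (not_le.2 hlt)
      · filter_upwards [(isOpen_lt continuous_snd hc).mem_nhds hgt] with q hq
        exact iff_of_true (le_of_lt hq) (le_of_lt hgt)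
    refine ContinuousAt.congr (f := fun _ => (U ∩ {x | p.2 ≤ side p.1 x}).indicator 1 x)
      continuousAt_const ?_
    filter_upwards [hev] with q hq
    have hiff : x ∈ U ∩ {x | p.2 ≤ side p.1 x} ↔ x ∈ U ∩ {x | q.2 ≤ side q.1 x} :=
      and_congr_right fun _ => hq.symm
    by_cases hmem : x ∈ U ∩ {x | p.2 ≤ side p.1 x}
    · rw [Set.indicator_of_mem hmem, Set.indicator_of_mem (hiff.1 hmem)]
    · rw [Set.indicator_of_notMem hmem, Set.indicator_of_notMem (mt hiff.2 hmem)]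

lemma continuous_measure_side_le (habs : μ ≪ volume) {U : Set Plane} (hU : MeasurableSet U) :
    Continuous fun p : ℝ × ℝ => μ.real (U ∩ {x | side p.1 x ≤ p.2}) := by
  have h := (continuous_measure_le_side habs hU).comp
    (f := fun p : ℝ × ℝ => (p.1 + Real.pi, -p.2)) (by fun_prop)
  simpa [Function.comp_def, side_add_pi] using h

lemma measure_side_le_add (habs : μ ≪ volume) {U : Set Plane} (hU : MeasurableSet U) (θ s : ℝ) :
    μ.real (U ∩ {x | side θ x ≤ s}) + μ.real (U ∩ {x | s ≤ side θ x}) = μ.real U := by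
  rw [← measureReal_union_add_inter (hU.inter (measurableSet_le_side θ s))]
  have h0 : μ.real (U ∩ {x | side θ x ≤ s} ∩ (U ∩ {x | s ≤ side θ x})) = 0 :=
    measureReal_mono_null (fun x hx => le_antisymm hx.1.2 hx.2.2) (measureReal_side_eq habs θ s)
  rw [h0, add_zero, ← Set.inter_union_distrib_left]
  congr 1
  exact Set.inter_eq_left.2 fun x _ => le_total (side θ x) s

omit [IsProbabilityMeasure μ] in
lemma exists_bound_support (hsupp : IsCompact μ.support) :
    ∃ R, ∀ U : Set Plane, ∀ θ s, R ≤ s → μ.real (U ∩ {x | s ≤ side θ x}) = 0 ∧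
      μ.real (U ∩ {x | -s ≤ side θ x}) = μ.real U := by
  obtain ⟨R, hR⟩ := hsupp.isBounded.exists_norm_le
  have hside : ∀ θ, ∀ x ∈ μ.support, |side θ x| < 2 * R + 1 := by
    intro θ x hx
    have h0 : |x 0| ≤ R := (PiLp.norm_apply_le x 0).trans (hR x hx)
    have h1 : |x 1| ≤ R := (PiLp.norm_apply_le x 1).trans (hR x hx)
    rw [side_apply]
    calc _ ≤ |Real.cos θ * x 0| + |Real.sin θ * x 1| := abs_add_le _ _
      _ ≤ 1 * R + 1 * R := by
        rw [abs_mul, abs_mul]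
        gcongr
        · exact Real.abs_cos_le_one θ
        · exact Real.abs_sin_le_one θ
      _ < _ := by linarith
  have hnull : μ μ.supportᶜ = 0 := Measure.measure_compl_support
  refine ⟨2 * R + 1, fun U θ s hs => ⟨?_, ?_⟩⟩
  · have : μ (U ∩ {x | s ≤ side θ x}) = 0 := by
      refine measure_mono_null (t := μ.supportᶜ) (fun x hx hxs => ?_) hnull
      have := (abs_lt.1 (hside θ x hxs)).2
      have hx2 : s ≤ side θ x := hx.2
      linarith
    rw [measureReal_def, this, ENNReal.toReal_zero]
  · have hae : ∀ᵐ x ∂μ, x ∈ μ.support := by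
      rw [ae_iff]
      exact hnull
    refine measureReal_congr ?_
    filter_upwards [hae] with x hx
    have := (abs_lt.1 (hside θ x hx)).1
    have hxs : -s ≤ side θ x := by linarith
    exact propext ⟨fun hxU => hxU.1, fun hxU => ⟨hxU, hxs⟩⟩

end Measure

/-! ### Successive cuts of two opposite regions. -/

section Step

variable {ι : Type*} {μ : ι → Measure Plane}

/-- Two opposite regions, each with its own set of players, can be cut simultaneously by a line
with direction between those of two given separating lines so that on each side one player gets
the prescribed share and no other player of that side would get more. -/
lemma exists_line_cutting [hprob : ∀ i, IsProbabilityMeasure (μ i)]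
    (habs : ∀ i, μ i ≪ volume) (hsupp : ∀ i, IsCompact (μ i).support)
    {U D : Set Plane} (hU : MeasurableSet U) (hD : MeasurableSet D) {a b sa sb : ℝ} (hab : a < b)
    (hUa : ∀ x ∈ U, side a x ≤ sa) (hDa : ∀ x ∈ D, sa ≤ side a x)
    (hUb : ∀ x ∈ U, sb ≤ side b x) (hDb : ∀ x ∈ D, side b x ≤ sb)
    {A B : Finset ι} (hA : A.Nonempty) (hB : B.Nonempty) {α β : ℝ} (hα : 0 < α) (hβ : 0 < β)
    (hUα : ∀ i ∈ A, α < (μ i).real U) (hDβ : ∀ i ∈ B, β < (μ i).real D) :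
    ∃ θ s, a < θ ∧ θ < b ∧
      (∃ i ∈ A, α ≤ (μ i).real (U ∩ {x | s ≤ side θ x})) ∧
      (∀ i ∈ A, (μ i).real (U ∩ {x | s ≤ side θ x}) ≤ α) ∧
      (∃ i ∈ B, β ≤ (μ i).real (D ∩ {x | side θ x ≤ s})) ∧
      (∀ i ∈ B, (μ i).real (D ∩ {x | side θ x ≤ s}) ≤ β) := by
  set f : ℝ → ℝ → ℝ := fun θ s => A.sup' hA fun i => (μ i).real (U ∩ {x | s ≤ side θ x}) with hf
  set g : ℝ → ℝ → ℝ := fun θ s => B.sup' hB fun i => (μ i).real (D ∩ {x | side θ x ≤ s}) with hg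
  have hfle : ∀ θ s, ∀ i ∈ A, (μ i).real (U ∩ {x | s ≤ side θ x}) ≤ f θ s := fun θ s i hi =>
    Finset.le_sup' (fun i => (μ i).real (U ∩ {x | s ≤ side θ x})) hi
  have hgle : ∀ θ s, ∀ i ∈ B, (μ i).real (D ∩ {x | side θ x ≤ s}) ≤ g θ s := fun θ s i hi =>
    Finset.le_sup' (fun i => (μ i).real (D ∩ {x | side θ x ≤ s})) hi
  have hfex : ∀ θ s, ∃ i ∈ A, f θ s = (μ i).real (U ∩ {x | s ≤ side θ x}) := fun θ s =>
    Finset.exists_mem_eq_sup' hA _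
  have hgex : ∀ θ s, ∃ i ∈ B, g θ s = (μ i).real (D ∩ {x | side θ x ≤ s}) := fun θ s =>
    Finset.exists_mem_eq_sup' hB _
  have hfc : Continuous (Function.uncurry f) :=
    Continuous.finset_sup'_apply hA fun i _ => continuous_measure_le_side (habs i) hU
  have hgc : Continuous (Function.uncurry g) :=
    Continuous.finset_sup'_apply hB fun i _ => continuous_measure_side_le (habs i) hD
  have hanti : ∀ θ, Antitone (f θ) := by
    intro θ s s' hs
    refine Finset.sup'_le _ _ fun i hi => le_trans ?_ (hfle θ s i hi)
    exact measureReal_mono fun x hx => ⟨hx.1, le_trans hs hx.2⟩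
  choose R hR using fun i => exists_bound_support (hsupp i)
  obtain ⟨i₀, hi₀⟩ := hA
  set R₀ := A.sup' ⟨i₀, hi₀⟩ R with hR₀
  have hRle : ∀ i ∈ A, R i ≤ R₀ := fun i hi => Finset.le_sup' R hi
  have hlow : ∀ θ, α < f θ (-R₀) := by
    intro θ
    refine (hUα i₀ hi₀).trans_le ((hfle θ (-R₀) i₀ hi₀).trans' ?_)
    exact ((hR i₀ U θ R₀ (hRle i₀ hi₀)).2).ge
  have hhigh : ∀ θ, f θ R₀ < α := by
    intro θ
    obtain ⟨i, hi, he⟩ := hfex θ R₀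
    rw [he, (hR i U θ R₀ (hRle i hi)).1]
    exact hα
  obtain ⟨θ, h1, h2, s, h3, h4⟩ := exists_common_value hab.le hfc hgc hanti hlow hhigh
    (α := α) (β := β) (by
      -- A positive share of `U` forces `s ≤ sa`, so the opposite piece of `D` lies in the initial
      -- line and is null.
      intro s hs
      obtain ⟨i, hi, he⟩ := hfex a s
      have hle : s ≤ sa := by
        by_contra! hcon
        have hempty : U ∩ {x | s ≤ side a x} = ∅ := Set.eq_empty_of_forall_notMem fun x hx =>
          absurd (hUa x hx.1) (not_le.2 (hcon.trans_le hx.2))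
        rw [← hs, he, hempty] at hα
        simp at hα
      obtain ⟨i', hi', he'⟩ := hgex a s
      rw [he']
      refine lt_of_eq_of_lt ?_ hβ
      exact measureReal_mono_null
        (fun x hx => le_antisymm (le_trans hx.2 hle) (hDa x hx.1)) (measureReal_side_eq (habs i') a sa))
    (by
      -- Since `α` is less than the mass of `U`, the line has passed `sb`, so the opposite piece is
      -- all of `D`.
      intro s hs
      have hle : sb ≤ s := by
        by_contra! hcon
        have hall : U ∩ {x | s ≤ side b x} = U :=
          Set.inter_eq_left.2 fun x hx => hcon.le.trans (hUb x hx)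
        have := hfle b s i₀ hi₀
        rw [hall, hs] at this
        exact absurd (hUα i₀ hi₀) (not_lt.2 this)
      obtain ⟨j, hj⟩ := hB
      refine (hDβ j hj).trans_le (le_trans ?_ (hgle b s j hj))
      exact measureReal_mono fun x hx => ⟨hx, (hDb x hx).trans hle⟩)
  obtain ⟨i, hi, he⟩ := hfex θ s
  obtain ⟨j, hj, he'⟩ := hgex θ s
  exact ⟨θ, s, h1, h2, ⟨i, hi, by rw [← he, h3]⟩, fun i hi => h3 ▸ hfle θ s i hi,
    ⟨j, hj, by rw [← he', h4]⟩, fun i hi => h4 ▸ hgle θ s i hi⟩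

/-- Iterated moving knives: two opposite regions are cut by successive lines whose directions
increase from `a` to `b`, and all players of both sides get their share. -/
lemma exists_lines_cutting [hprob : ∀ i, IsProbabilityMeasure (μ i)]
    (habs : ∀ i, μ i ≪ volume) (hsupp : ∀ i, IsCompact (μ i).support) {b sb : ℝ} (m : ℕ) :
    ∀ {U D : Set Plane} {a sa : ℝ} {A B : Finset ι} {α β : ℕ → ℝ},
      MeasurableSet U → MeasurableSet D → a < b →
      (∀ x ∈ U, side a x ≤ sa) → (∀ x ∈ D, sa ≤ side a x) →
      (∀ x ∈ U, sb ≤ side b x) → (∀ x ∈ D, side b x ≤ sb) →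
      A.card = m + 1 → B.card = m + 1 → (∀ j ≤ m, 0 < α j) → (∀ j ≤ m, 0 < β j) →
      (∀ i ∈ A, ∑ j ∈ Finset.range (m + 1), α j ≤ (μ i).real U) →
      (∀ i ∈ B, ∑ j ∈ Finset.range (m + 1), β j ≤ (μ i).real D) →
      ∃ (θ s : ℕ → ℝ) (p q : ℕ → ι),
        θ 0 = a ∧ s 0 = sa ∧ θ (m + 1) = b ∧ s (m + 1) = sb ∧
        (∀ j ≤ m, θ j < θ (j + 1)) ∧
        (∀ j ≤ m, p j ∈ A) ∧ (∀ j ≤ m, q j ∈ B) ∧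
        Set.InjOn p (Set.Iic m) ∧ Set.InjOn q (Set.Iic m) ∧
        (∀ i ≤ m, α i ≤ (μ (p i)).real (U ∩ {x | (∀ j, 1 ≤ j → j ≤ i → side (θ j) x ≤ s j) ∧
          s (i + 1) ≤ side (θ (i + 1)) x})) ∧
        (∀ i ≤ m, β i ≤ (μ (q i)).real (D ∩ {x | (∀ j, 1 ≤ j → j ≤ i → s j ≤ side (θ j) x) ∧
          side (θ (i + 1)) x ≤ s (i + 1)})) := by
  classical
  induction m with
  | zero =>
    intro U D a sa A B α β _ _ hab hUa hDa hUb hDb hA hB hα hβ hUα hDβ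
    obtain ⟨p, hp⟩ := Finset.card_pos.1 (by omega : 0 < A.card)
    obtain ⟨q, hq⟩ := Finset.card_pos.1 (by omega : 0 < B.card)
    refine ⟨fun j => if j = 0 then a else b, fun j => if j = 0 then sa else sb, fun _ => p,
      fun _ => q, by simp, by simp, by simp, by simp, ?_, fun _ _ => hp, fun _ _ => hq, ?_, ?_,
      ?_, ?_⟩
    · intro j hj
      obtain rfl : j = 0 := by omega
      simpa using hab
    · intro i hi j hj _
      simp only [Set.mem_Iic] at hi hj
      omega
    · intro i hi j hj _
      simp only [Set.mem_Iic] at hi hj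
      omega
    · intro i hi
      obtain rfl : i = 0 := by omega
      have h1 := hUα p hp
      refine le_trans (by simpa using h1) (measureReal_mono (s₁ := U) fun x hx =>
        ⟨hx, fun j h1 h2 => by omega, by simpa using hUb x hx⟩)
    · intro i hi
      obtain rfl : i = 0 := by omega
      have h1 := hDβ q hq
      refine le_trans (by simpa using h1) (measureReal_mono (s₁ := D) fun x hx =>
        ⟨hx, fun j h1 h2 => by omega, by simpa using hDb x hx⟩)
  | succ m ih =>
    intro U D a sa A B α β hU hD hab hUa hDa hUb hDb hA hB hα hβ hUα hDβ
    -- Positive future shares give the strict inequalities `exists_line_cutting` requires.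
    have hαpos : 0 < ∑ j ∈ Finset.range (m + 1), α (j + 1) :=
      Finset.sum_pos (fun j hj => hα _ (by simpa [Nat.lt_succ_iff] using hj)) (by simp)
    have hβpos : 0 < ∑ j ∈ Finset.range (m + 1), β (j + 1) :=
      Finset.sum_pos (fun j hj => hβ _ (by simpa [Nat.lt_succ_iff] using hj)) (by simp)
    simp only [Finset.sum_range_succ' _ (m + 1)] at hUα hDβ
    obtain ⟨θ', s', h1, h2, ⟨p₀, hp₀, hp₀'⟩, hA', ⟨q₀, hq₀, hq₀'⟩, hB'⟩ :=
      exists_line_cutting habs hsupp hU hD hab hUa hDa hUb hDb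
        (Finset.card_pos.1 (by omega : 0 < A.card)) (Finset.card_pos.1 (by omega : 0 < B.card))
        (hα 0 (by omega)) (hβ 0 (by omega)) (fun i hi => by linarith [hUα i hi])
        (fun i hi => by linarith [hDβ i hi])
    obtain ⟨θ, s, p, q, hθ0, hs0, hθm, hsm, hθ, hpA, hqB, hp, hq, hpα, hqβ⟩ :=
      ih (U := U ∩ {x | side θ' x ≤ s'}) (D := D ∩ {x | s' ≤ side θ' x}) (a := θ') (sa := s')
        (A := A.erase p₀) (B := B.erase q₀) (α := fun j => α (j + 1)) (β := fun j => β (j + 1))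
        (hU.inter (measurableSet_side_le _ _)) (hD.inter (measurableSet_le_side _ _)) h2
        (fun x hx => hx.2) (fun x hx => hx.2) (fun x hx => hUb x hx.1) (fun x hx => hDb x hx.1)
        (by rw [Finset.card_erase_of_mem hp₀]; omega) (by rw [Finset.card_erase_of_mem hq₀]; omega)
        (fun j hj => hα _ (by omega)) (fun j hj => hβ _ (by omega))
        (fun i hi => by
          have hi' := Finset.mem_of_mem_erase hi
          linarith [hUα i hi', hA' i hi', measure_side_le_add (habs i) hU θ' s'])
        (fun i hi => by
          have hi' := Finset.mem_of_mem_erase hi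
          linarith [hDβ i hi', hB' i hi', measure_side_le_add (habs i) hD θ' s'])
    have hinj : ∀ (r : ℕ → ι) (r₀ : ι) (C : Finset ι), (∀ j ≤ m, r j ∈ C.erase r₀) →
        Set.InjOn r (Set.Iic m) →
        Set.InjOn (fun j => Nat.casesOn j r₀ r : ℕ → ι) (Set.Iic (m + 1)) := by
      intro r r₀ C hr hinj i hi j hj hij
      rcases i with _ | i <;> rcases j with _ | j
      · rfl
      · exact absurd hij.symm (Finset.ne_of_mem_erase (hr j (by simpa using hj)))
      · exact absurd hij (Finset.ne_of_mem_erase (hr i (by simpa using hi)))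
      · rw [hinj (by simpa using hi) (by simpa using hj) hij]
    refine ⟨fun j => Nat.casesOn j a θ, fun j => Nat.casesOn j sa s, fun j => Nat.casesOn j p₀ p,
      fun j => Nat.casesOn j q₀ q, rfl, rfl, hθm, hsm, ?_, ?_, ?_, hinj p p₀ A hpA hp,
      hinj q q₀ B hqB hq, ?_, ?_⟩
    · rintro (_ | j) hj
      · simpa [hθ0] using h1
      · exact hθ j (by omega)
    · rintro (_ | j) hj
      · exact hp₀
      · exact Finset.mem_of_mem_erase (hpA j (by omega))
    · rintro (_ | j) hj
      · exact hq₀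
      · exact Finset.mem_of_mem_erase (hqB j (by omega))
    · rintro (_ | i) hi
      · refine hp₀'.trans (measureReal_mono fun x hx => ⟨hx.1, fun j h1 h2 => by omega, ?_⟩)
        simpa [hθ0, hs0] using hx.2
      · refine (hpα i (by omega)).trans (measureReal_mono fun x hx => ⟨hx.1.1, ?_, hx.2.2⟩)
        rintro (_ | _ | j) h1 h2
        · omega
        · simpa [hθ0, hs0] using hx.1.2
        · exact hx.2.1 (j + 1) (by omega) (by omega)
    · rintro (_ | i) hi
      · refine hq₀'.trans (measureReal_mono fun x hx => ⟨hx.1, fun j h1 h2 => by omega, ?_⟩)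
        simpa [hθ0, hs0] using hx.2
      · refine (hqβ i (by omega)).trans (measureReal_mono fun x hx => ⟨hx.1.1, ?_, hx.2.2⟩)
        rintro (_ | _ | j) h1 h2
        · omega
        · simpa [hθ0, hs0] using hx.1.2
        · exact hx.2.1 (j + 1) (by omega) (by omega)

end Step

/-! ### Closing the cycle, the first cut, and assembly. -/

lemma exists_isLineCycle {k : ℕ} (hk : 0 < k) {θ s : ℕ → ℝ} (hθ : ∀ j < k, θ j < θ (j + 1))
    (hθk : θ k = θ 0 + Real.pi) (hsk : s k = -s 0) :
    ∃ θ' s' : ℕ → ℝ, IsLineCycle k θ' s' ∧ ∀ j ≤ k, θ' j = θ j ∧ s' j = s j := by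
  -- Each pass through the `k` lines adds `π` and flips the sign of the offset.
  refine ⟨fun j => θ (j % k) + (j / k : ℕ) * Real.pi, fun j => (-1) ^ (j / k) * s (j % k),
    ⟨hk, strictMono_nat_of_lt_succ fun j => ?_, fun j => ?_, fun j => ?_⟩, fun j hj => ?_⟩
  · have hlt := Nat.mod_lt j hk
    rcases (Nat.succ_le_of_lt hlt).lt_or_eq with h | h
    · have h1 : (j + 1) % k = j % k + 1 := by
        rw [Nat.add_mod, Nat.mod_eq_of_lt (show 1 < k by omega), Nat.mod_eq_of_lt h]
      have h2 : (j + 1) / k = j / k := by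
        rw [Nat.succ_div, if_neg, add_zero]
        intro hd
        have := Nat.mod_eq_zero_of_dvd hd
        omega
      rw [h1, h2]
      linarith [hθ _ hlt]
    · have hd : k ∣ j + 1 := by
        refine ⟨j / k + 1, ?_⟩
        have := Nat.div_add_mod j k
        rw [mul_add]
        omega
      have h1 : (j + 1) % k = 0 := Nat.mod_eq_zero_of_dvd hd
      have h2 : (j + 1) / k = j / k + 1 := by rw [Nat.succ_div, if_pos hd]
      have h3 := hθ _ hlt
      rw [← Nat.succ_eq_add_one, h, hθk] at h3
      rw [h1, h2]
      push_cast
      linarith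
  · simp only [Nat.add_mod_right, Nat.add_div_right j hk]
    push_cast
    ring
  · simp only [Nat.add_mod_right, Nat.add_div_right j hk, pow_succ]
    ring
  · rcases hj.lt_or_eq with h | rfl
    · simp [Nat.mod_eq_of_lt h, Nat.div_eq_of_lt h]
    · simp [Nat.div_self hk, hθk, hsk]

/-- The first cut: a line of given direction leaves `k` players content with its back side and the
others content with its front side. -/
lemma exists_halving_players {k : ℕ} (hk : 0 < k) {μ : Fin (2 * k) → Measure Plane}
    [hprob : ∀ i, IsProbabilityMeasure (μ i)]
    (habs : ∀ i, μ i ≪ volume) (hsupp : ∀ i, IsCompact (μ i).support)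
    (θ : ℝ) {c d : ℝ} (hc : 0 ≤ c) (hd : 0 ≤ d) (hcd : c + d = 1) :
    ∃ (s : ℝ) (A : Finset (Fin (2 * k))), A.card = k ∧
      (∀ i ∈ A, c ≤ (μ i).real {x | side θ x ≤ s}) ∧
      (∀ i ∉ A, d ≤ (μ i).real {x | s ≤ side θ x}) := by
  have hex : ∀ i, ∃ s, c = (μ i).real {x | side θ x ≤ s} ∧ d = (μ i).real {x | s ≤ side θ x} := by
    intro i
    obtain ⟨R, hR⟩ := exists_bound_support (hsupp i)
    have h1 := (hR Set.univ θ (max R 0) (le_max_left _ _)).1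
    have h2 := (hR Set.univ θ (max R 0) (le_max_left _ _)).2
    have hcont : Continuous fun s : ℝ => (μ i).real (Set.univ ∩ {x | s ≤ side θ x}) :=
      (continuous_measure_le_side (habs i) MeasurableSet.univ).comp (Continuous.prodMk_right θ)
    obtain ⟨s, -, hs⟩ := intermediate_value_Icc'
      (show -max R 0 ≤ max R 0 by linarith [le_max_right R 0]) hcont.continuousOn
      (show d ∈ Set.Icc _ _ by
        simp only [h1, h2, probReal_univ]
        exact ⟨hd, by linarith⟩)
    have hadd := measure_side_le_add (habs i) MeasurableSet.univ θ s
    simp only [Set.univ_inter, probReal_univ] at hs hadd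
    exact ⟨s, by linarith, hs.symm⟩
  choose σ hσ using hex
  set τ := Tuple.sort σ with hτ
  have hmono : Monotone (σ ∘ τ) := Tuple.monotone_sort σ
  -- Indices start at `0`, so this is the `k`-th smallest position.
  set j₀ : Fin (2 * k) := ⟨k - 1, by omega⟩ with hj₀
  refine ⟨σ (τ j₀), (Finset.Iic j₀).map τ.toEmbedding, ?_, ?_, ?_⟩
  · rw [Finset.card_map, Fin.card_Iic]
    simp only [hj₀]
    omega
  · intro i hi
    obtain ⟨j, hj, rfl⟩ := Finset.mem_map.1 hi
    refine (hσ (τ j)).1.le.trans (measureReal_mono fun x hx => ?_)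
    exact le_trans hx (hmono (Finset.mem_Iic.1 hj))
  · intro i hi
    obtain ⟨j, rfl⟩ := τ.surjective i
    have hj : j₀ ≤ j := by
      by_contra! hcon
      exact hi (Finset.mem_map.2 ⟨j, Finset.mem_Iic.2 hcon.le, rfl⟩)
    refine (hσ (τ j)).2.le.trans (measureReal_mono fun x hx => ?_)
    exact le_trans (hmono hj) hx

/-- With empty interior the set would lie in its frontier, which is null by convexity. -/
lemma Convex.nonempty_interior_of_measureReal_pos {μ : Measure Plane} (habs : μ ≪ volume)
    {Q : Set Plane} (hQ : Convex ℝ Q) (hpos : 0 < μ.real Q) : (interior Q).Nonempty := by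
  by_contra hne
  have hsub : Q ⊆ frontier Q := fun x hx =>
    ⟨subset_closure hx, by rw [Set.not_nonempty_iff_eq_empty.1 hne]; exact Set.notMem_empty x⟩
  have h0 : μ Q = 0 := habs (measure_mono_null hsub (Convex.addHaar_frontier volume hQ))
  rw [measureReal_def, h0] at hpos
  simp at hpos

theorem mainTheorem1 (k : ℕ)
    (μ : Fin (2 * k) → Measure Plane) (hprob : ∀ i, IsProbabilityMeasure (μ i))
    (habs : ∀ i, μ i ≪ (volume : Measure Plane))
    (hsupp : ∀ i, IsCompact (μ i).support)
    (α : Fin (2 * k) → ℝ) (hα : ∀ i, 0 < α i) (hsum : ∑ i, α i = 1) :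
    ∃ (L : Fin k → AffineSubspace ℝ Plane) (Q : Fin (2 * k) → Set Plane)
      (π : Equiv.Perm (Fin (2 * k))),
      IsConvexPartitionByLines L Q ∧ InCounterclockwiseOrder Q ∧
      ∀ i, α i ≤ (μ (π i)).real (Q i) := by
  classical
  have hkpos : k ≠ 0 := by
    rintro rfl
    exact absurd hsum (by simp)
  obtain ⟨m, hk⟩ := Nat.exists_eq_succ_of_ne_zero hkpos
  rw [Nat.succ_eq_add_one] at hk
  set α' : ℕ → ℝ := fun j => if h : j < 2 * k then α ⟨j, h⟩ else 0 with hα'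
  have hα'pos : ∀ j < 2 * k, 0 < α' j := fun j hj => by
    simp only [hα', dif_pos hj]
    exact hα _
  have hα'val : ∀ i : Fin (2 * k), α' i = α i := fun i => by simp [hα']
  have hsum' : ∑ j ∈ Finset.range k, α' j + ∑ j ∈ Finset.range k, α' (k + j) = 1 := by
    rw [← Finset.sum_range_add, ← two_mul, ← hsum, ← Fin.sum_univ_eq_sum_range]
    exact Finset.sum_congr rfl fun i _ => hα'val i
  obtain ⟨s₀, A, hAcard, hA, hB⟩ := exists_halving_players (k := k) (by omega) habs hsupp
    (-(Real.pi / 2))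
    (Finset.sum_nonneg fun j hj => (hα'pos j (by have := Finset.mem_range.1 hj; omega)).le)
    (Finset.sum_nonneg fun j hj => (hα'pos (k + j) (by have := Finset.mem_range.1 hj; omega)).le)
    hsum'
  -- The final line is the starting line reversed, so its side conditions are automatic and the
  -- cycle closes.
  obtain ⟨θ', s', p, q, hθ0, hs0, hθk, hsk, hθ, hp, hq, hpinj, hqinj, hpα, hqα⟩ :=
    exists_lines_cutting habs hsupp (b := -(Real.pi / 2) + Real.pi) (sb := -s₀) m
      (U := {x | side (-(Real.pi / 2)) x ≤ s₀}) (D := {x | s₀ ≤ side (-(Real.pi / 2)) x})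
      (a := -(Real.pi / 2)) (sa := s₀) (A := A) (B := Aᶜ) (α := α') (β := fun j => α' (k + j))
      (measurableSet_side_le _ _) (measurableSet_le_side _ _) (by linarith [Real.pi_pos])
      (fun x hx => hx) (fun x hx => hx)
      (fun x hx => by rw [side_add_pi]; exact neg_le_neg hx)
      (fun x hx => by rw [side_add_pi]; exact neg_le_neg hx)
      (hAcard.trans hk) (by rw [Finset.card_compl, hAcard, Fintype.card_fin]; omega)
      (fun j hj => hα'pos j (by omega)) (fun j hj => hα'pos (k + j) (by omega))
      (by rwa [← hk]) (by
        rw [← hk]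
        exact fun i hi => hB i (Finset.mem_compl.1 hi))
  rw [← hk] at hθk hsk
  obtain ⟨θ, s, hcyc, hext⟩ := exists_isLineCycle (k := k) (θ := θ') (s := s') (by omega)
    (fun j hj => hθ j (by omega)) (by rw [hθk, hθ0]) (by rw [hsk, hs0])
  set f : Fin (2 * k) → Fin (2 * k) := fun i => if (i : ℕ) < k then p i else q (i - k) with hf
  -- The two halves of the indices are served by the disjoint groups `A` and `Aᶜ`.
  have hfinj : Function.Injective f := by
    intro i j hij
    simp only [hf] at hij
    have hi := i.2
    have hj := j.2
    split_ifs at hij with h1 h2 h2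
    · exact Fin.ext (hpinj (Set.mem_Iic.2 (by omega)) (Set.mem_Iic.2 (by omega)) hij)
    · have := hq (j - k) (by omega)
      rw [← hij] at this
      exact absurd (hp i (by omega)) (Finset.mem_compl.1 this)
    · have := hq (i - k) (by omega)
      rw [hij] at this
      exact absurd (hp j (by omega)) (Finset.mem_compl.1 this)
    · have := hqinj (Set.mem_Iic.2 (by omega)) (Set.mem_Iic.2 (by omega)) hij
      exact Fin.ext (by omega)
  have hshare : ∀ i : Fin (2 * k), α i ≤ (μ (f i)).real (region k θ s i) := by
    intro i
    have hi := i.2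
    rw [← hα'val]
    by_cases h : (i : ℕ) < k
    · simp only [hf, if_pos h]
      refine (hpα i (by omega)).trans (measureReal_mono fun x hx => ⟨fun j hj _ => ?_, ?_⟩)
      · rw [(hext j (by omega)).1, (hext j (by omega)).2]
        rcases Nat.eq_zero_or_pos j with rfl | hj0
        · rw [hθ0, hs0]
          exact hx.1
        · exact hx.2.1 j hj0 hj
      · rw [(hext _ (by omega)).1, (hext _ (by omega)).2]
        exact hx.2.2
    · obtain ⟨n, hn⟩ := Nat.exists_eq_add_of_le' (not_lt.1 h)
      simp only [hf, if_neg h]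
      rw [hn, Nat.add_sub_cancel]
      have hle := hqα n (by omega)
      rw [add_comm k n] at hle
      refine hle.trans (measureReal_mono fun x hx => ⟨fun j hj hjk => ?_, ?_⟩)
      · obtain ⟨j, rfl⟩ := Nat.exists_eq_add_of_le' (show k ≤ j by omega)
        rw [hcyc.side_le_iff, (hext j (by omega)).1, (hext j (by omega)).2]
        rcases Nat.eq_zero_or_pos j with rfl | hj0
        · rw [hθ0, hs0]
          exact hx.1
        · exact hx.2.1 j hj0 (by omega)
      · rw [show n + k + 1 = n + 1 + k by omega, hcyc.le_side_iff, (hext _ (by omega)).1,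
          (hext _ (by omega)).2]
        exact hx.2.2
  refine ⟨_, _, Equiv.ofBijective f (Finite.injective_iff_bijective.1 hfinj),
    hcyc.isConvexPartitionByLines fun i hi => ?_, hcyc.inCounterclockwiseOrder, hshare⟩
  exact (convex_region i).nonempty_interior_of_measureReal_pos (habs (f ⟨i, hi⟩))
    ((hα ⟨i, hi⟩).trans_le (hshare ⟨i, hi⟩))
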